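/- For a binary linear code $\mathcal D\le\mathbb F_2^n$ let $\mathcal D^\perp$ denote its dual with respect to the standard inner product, and for a nonzero binary linear code $\mathcal C$ let $d(\mathcal C)=\min\{\mathrm{wt}(c)\mid 0\ne c\in\mathcal C\}$ denote its minimum distance. The code $\mathcal D$ is called semi self-dual if $\mathcal D\subseteq\mathcal D^\perp$, the all-ones vector $(1,\dots,1)$ lies in $\mathcal D$, and $\dim(\mathcal D^\perp/\mathcal D)=2$; it is called doubly-even if $4\mid\mathrm{wt}(c)$ for all $c\in\mathcal D$. Theorem. Let $\mathcal D\le\mathbb F_2^n$ be a semi self-dual code (its length $n$ is then even and positive). Then $$d(\mathcal D^\perp)\le\begin{cases}4\lfloor n/24\rfloor+2&\text{if } n\equiv 0,2,4,6,8,10,12,14\pmod{24},\\ 4\lfloor n/24\rfloor+4&\text{if } n\equiv 16,18,20\pmod{24},\\ 4\lfloor n/24\rfloor+6&\text{if } n\equiv 22\pmod{24}.\end{cases}$$ Moreover, if $n=24\mu$ for some integer $\mu$, and if $\mathcal D$ is doubly-even or $\binom{5\mu-1}{\mu-1}$ is odd, then $d(\mathcal D^\perp)\le 4\mu$. -/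

import Mathlib

namespace BinaryCode

/-- A binary linear code of length `n`: a subspace of `𝔽₂ⁿ`. -/
abbrev Code (n : ℕ) : Type := Submodule (ZMod 2) (Fin n → ZMod 2)

/-- The dual code with respect to the standard bilinear form on `𝔽₂ⁿ`. -/
def dual {n : ℕ} (D : Code n) : Code n where
  carrier := {v | ∀ c ∈ D, v ⬝ᵥ c = 0}
  zero_mem' := fun c _ => zero_dotProduct c
  add_mem' := fun {a b} ha hb c hc => by
    rw [add_dotProduct, ha c hc, hb c hc, add_zero]
  smul_mem' := fun r a ha c hc => by
    rw [smul_dotProduct, ha c hc, smul_zero]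

/-- The minimum Hamming weight of the nonzero codewords, which for a linear code is its
minimum distance. It is a natural number for `C ≠ 0`, and `⊤` for the zero code. -/
noncomputable def minDist {n : ℕ} (C : Code n) : ℕ∞ :=
  ⨅ c ∈ {c : Fin n → ZMod 2 | c ∈ C ∧ c ≠ 0}, (hammingNorm c : ℕ∞)

/-- All codewords have weight divisible by `4`. -/
def IsDoublyEven {n : ℕ} (D : Code n) : Prop :=
  ∀ c ∈ D, 4 ∣ hammingNorm c

/-- Semi self-dual codes: self-orthogonal binary codes that contain the all-ones vector and
satisfy `dim (D^⊥ / D) = 2`. -/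
structure IsSemiSelfDual {n : ℕ} (D : Code n) : Prop where
  self_orthogonal : D ≤ dual D
  one_mem : (1 : Fin n → ZMod 2) ∈ D
  finrank_quotient :
    Module.finrank (ZMod 2) (↥(dual D) ⧸ D.submoduleOf (dual D)) = 2

end BinaryCode

/-! Let `n = 2N`, and let W, W' be the weight enumerators of D and its dual in X = y². Here 2|D| =
2^N and the dual has 4|D| words. Fourier analysis of the twists c ↦ i^wt(c) (-1)^(v·c) writes 2W -
W' and 2W + W', up to a positive factor, as sums of (1 - iy)^(2N-wt v) (1 + iy)^(wt v) over the
shadow words v with wt v ≡ N + 2, respectively N, mod 4 (`aeval_halfEnum_add`). Averaging over y ↦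
-y and expanding power sums turns these into combinations of (1 - 6X + X²)(X(1-X)²)^j
(1+X)^(N-2-4j), respectively (X(1-X)²)^j (1+X)^(N-4j), whose coefficients are (-64)^j times
nonnegative numbers (`halfEnum_sub`, `halfEnum_add`).

If all nonzero dual words had weight above 2i, then W and W' would be 1 up to order i, so 2W - W'
and 2W + W' would agree with 1 and 3 there. Lagrange inversion in φ = X(1-X)²/(1+X)⁴ then gives the
i-th coefficient of each expansion as an explicit power series coefficient (`pow_mul_coeff_bin_odd`,
`pow_mul_coeff_bin_even`), whose sign is read off from (1+X)^b/(1-X²)^(d+1). A clash with the sign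
(-1)^i proves the first two bounds; in the third the coefficient vanishes, which forces the next one
to vanish too, and that one does not. For n = 24μ and i = 2μ the signs agree. The contradiction then
comes from a light shadow word lying in the dual (doubly-even case) or from parity under v ↦ v + 1.
-/

namespace PowerSeries

/-! ### Laurent monomials in 1 + X and 1 - X, and Lagrange residues -/

open Finset

/-- `1 + X` as a unit of `ℤ⟦X⟧`. -/
noncomputable def onePlusX : ℤ⟦X⟧ˣ :=
  (isUnit_iff_constantCoeff.2 (by simp) : IsUnit (1 + X : ℤ⟦X⟧)).unit

/-- `1 - X` as a unit of `ℤ⟦X⟧`. -/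
noncomputable def oneSubX : ℤ⟦X⟧ˣ :=
  (isUnit_iff_constantCoeff.2 (by simp) : IsUnit (1 - X : ℤ⟦X⟧)).unit

@[simp] lemma coe_onePlusX : (onePlusX : ℤ⟦X⟧) = 1 + X := rfl

@[simp] lemma coe_oneSubX : (oneSubX : ℤ⟦X⟧) = 1 - X := rfl

/-- The Laurent monomial `(1 + X) ^ a * (1 - X) ^ b`. -/
noncomputable def bin (a b : ℤ) : ℤ⟦X⟧ := ((onePlusX ^ a * oneSubX ^ b : ℤ⟦X⟧ˣ) : ℤ⟦X⟧)

lemma bin_mul_bin (a b c d : ℤ) : bin a b * bin c d = bin (a + c) (b + d) := by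
  rw [bin, bin, bin, ← Units.val_mul, zpow_add, zpow_add, mul_mul_mul_comm]

@[simp] lemma bin_zero : bin 0 0 = 1 := by simp [bin]

lemma bin_natCast (a b : ℕ) : bin a b = (1 + X) ^ a * (1 - X) ^ b := by
  simp [bin]

lemma bin_mul_eq_one (a b : ℤ) : bin a b * bin (-a) (-b) = 1 := by
  rw [bin_mul_bin]; simp

lemma one_add_X_mul_bin (a b : ℤ) : (1 + X) * bin a b = bin (a + 1) b := by
  have h := bin_mul_bin 1 0 a b
  rw [show bin 1 0 = 1 + X by simp [bin]] at h
  rw [h]; congr 1 <;> ring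

lemma one_sub_X_mul_bin (a b : ℤ) : (1 - X) * bin a b = bin a (b + 1) := by
  have h := bin_mul_bin 0 1 a b
  rw [show bin 0 1 = 1 - X by simp [bin]] at h
  rw [h]; congr 1 <;> ring

lemma derivative_units_zpow (u : ℤ⟦X⟧ˣ) (a : ℤ) :
    d⁄dX ℤ ((u ^ a : ℤ⟦X⟧ˣ) : ℤ⟦X⟧) = a * ((u ^ (a - 1) : ℤ⟦X⟧ˣ) : ℤ⟦X⟧) * d⁄dX ℤ (u : ℤ⟦X⟧) := by
  have step : ∀ a : ℤ, d⁄dX ℤ ((u ^ (a + 1) : ℤ⟦X⟧ˣ) : ℤ⟦X⟧) =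
      (u ^ a : ℤ⟦X⟧ˣ) * d⁄dX ℤ (u : ℤ⟦X⟧) + u * d⁄dX ℤ ((u ^ a : ℤ⟦X⟧ˣ) : ℤ⟦X⟧) := by
    intro a
    rw [zpow_add_one, Units.val_mul, Derivation.leibniz, smul_eq_mul, smul_eq_mul]
  have pred : ∀ a : ℤ, ((u ^ a : ℤ⟦X⟧ˣ) : ℤ⟦X⟧) = u * (u ^ (a - 1) : ℤ⟦X⟧ˣ) := by
    intro a
    rw [← Units.val_mul, ← zpow_one_add]; congr 2; ring
  induction a using Int.induction_on with
  | zero => simp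
  | succ k ih =>
    rw [step, ih, add_sub_cancel_right, pred k]
    push_cast; ring
  | pred k ih =>
    have h := step (-k - 1)
    rw [sub_add_cancel, ih] at h
    refine u.isUnit.mul_left_cancel (?_ : (u : ℤ⟦X⟧) * _ = u * _)
    have h2 := congrArg (· * d⁄dX ℤ (u : ℤ⟦X⟧)) (pred (-k - 1))
    push_cast at h h2 ⊢
    linear_combination -h - (k + 1) * h2

lemma derivative_bin (a b : ℤ) :
    d⁄dX ℤ (bin a b) = ((a : ℤ⟦X⟧) * (1 - (X : ℤ⟦X⟧)) - (b : ℤ⟦X⟧) * (1 + (X : ℤ⟦X⟧))) * bin (a - 1) (b - 1) := by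
  have hA : ((onePlusX ^ a : ℤ⟦X⟧ˣ) : ℤ⟦X⟧) = (1 + (X : ℤ⟦X⟧)) * (onePlusX ^ (a - 1) : ℤ⟦X⟧ˣ) := by
    rw [← coe_onePlusX, ← Units.val_mul, ← zpow_one_add]; congr 2; ring
  have hB : ((oneSubX ^ b : ℤ⟦X⟧ˣ) : ℤ⟦X⟧) = (1 - (X : ℤ⟦X⟧)) * (oneSubX ^ (b - 1) : ℤ⟦X⟧ˣ) := by
    rw [← coe_oneSubX, ← Units.val_mul, ← zpow_one_add]; congr 2; ring
  rw [bin, bin, Units.val_mul, Units.val_mul, Derivation.leibniz, derivative_units_zpow,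
    derivative_units_zpow, hA, hB]
  simp only [smul_eq_mul, coe_onePlusX, coe_oneSubX, map_add, map_sub, derivative_X,
    Derivation.map_one_eq_zero]
  ring

/-- The logarithmic derivative identity underlying the Bürmann–Lagrange coefficients of
`1` in powers of `X * (1 - X) ^ 2 / (1 + X) ^ 4`. -/
lemma mul_coeff_bin (N i : ℕ) :
    ((i + 1 : ℕ) : ℤ) * coeff (i + 1)
      ((1 - 6 * X + X ^ 2) * bin (4 * (i + 1 : ℕ) - N - 1) (-2 * (i + 1 : ℕ) - 1)) =
    -N * coeff i (bin (4 * (i + 1 : ℕ) - N - 1) (-2 * (i + 1 : ℕ))) := by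
  set χ := bin (4 * (i + 1 : ℕ) - N - 1) (-2 * (i + 1 : ℕ) - 1) with hχ
  have h1 : (1 - X) * χ = bin (4 * (i + 1 : ℕ) - N - 1) (-2 * (i + 1 : ℕ)) := by
    rw [hχ, one_sub_X_mul_bin, sub_add_cancel]
  have h2 : (1 + X) * ((1 - X) * χ) = bin (4 * (i + 1 : ℕ) - N) (-2 * (i + 1 : ℕ)) := by
    rw [h1, one_add_X_mul_bin, sub_add_cancel]
  have h3 := derivative_bin (4 * (i + 1 : ℕ) - N) (-2 * (i + 1 : ℕ))
  rw [← hχ, ← h2] at h3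
  -- The first two terms on the right cancel at X^(i+1), because X d/dX multiplies that coefficient
  -- by i + 1.
  have h4 : (((i + 1 : ℕ) : ℤ) : ℤ⟦X⟧) * ((1 - 6 * X + X ^ 2) * χ) =
      (((i + 1 : ℕ) : ℤ) : ℤ⟦X⟧) * ((1 + X) * ((1 - X) * χ))
        - X * d⁄dX ℤ ((1 + X) * ((1 - X) * χ)) + X * (((-N : ℤ) : ℤ⟦X⟧) * ((1 - X) * χ)) := by
    rw [h3]; push_cast; ring
  have h5 := congrArg (coeff (i + 1)) h4
  have hC : ∀ k : ℤ, (k : ℤ⟦X⟧) = C k := fun k => by simp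
  simp only [map_add, map_sub, coeff_succ_X_mul, coeff_derivative, hC, coeff_C_mul] at h5
  rw [← h1, h5]
  push_cast; ring

/-- Biorthogonality of the Bürmann–Lagrange functionals. -/
lemma coeff_bin_eq_ite (d : ℕ) :
    coeff d ((1 - 6 * X + X ^ 2) * bin (4 * d - 1) (-2 * d - 1)) = if d = 0 then 1 else 0 := by
  rcases d with _ | d
  · have h : bin (-1) (-1) * ((1 + X) * (1 - X)) = 1 := by
      have := bin_mul_eq_one (-1) (-1)
      rw [show bin (- -1) (- -1) = (1 + X) * (1 - X) by simp [bin]] at this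
      exact this
    have h2 := congrArg constantCoeff h
    simp at h2
    simpa using h2
  -- At N = 0 this says that φ'/φ^(d+2) has no residue, being a derivative.
  · have h := mul_coeff_bin 0 d
    simp only [Nat.cast_zero, neg_zero, zero_mul, sub_zero] at h
    rw [if_neg (Nat.succ_ne_zero d)]
    exact (mul_eq_zero.1 h).resolve_left (by positivity)

/-- The expansion of `1 / (1 - X ^ 2) ^ (d + 1)`. -/
lemma bin_neg_neg (d : ℕ) : bin (-(d + 1 : ℕ)) (-(d + 1 : ℕ)) =
    mk fun m => if Even m then ((d + m / 2).choose d : ℤ) else 0 := by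
  have step : ∀ F G : ℕ → ℤ, (∀ m, F (m + 2) - F m = G (m + 2)) → F 0 = G 0 → F 1 = G 1 →
      (1 + X) * ((1 - X) * mk F) = mk G := by
    intro F G h h0 h1
    have : (1 + X) * ((1 - X) * mk F) = mk F - X * (X * mk F) := by ring
    rw [this]
    ext m
    rcases m with _ | _ | m
    · simp [h0]
    · rw [map_sub, coeff_succ_X_mul, coeff_zero_X_mul]; simp [h1]
    · rw [map_sub, coeff_succ_X_mul, coeff_succ_X_mul]; simp [← h m]
  have key : ∀ a : ℤ, ∀ p q : ℤ⟦X⟧, (1 + X) * ((1 - X) * p) = q → q = bin (-a) (-a) →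
      p = bin (-(a + 1)) (-(a + 1)) := by
    intro a p q h1 h2
    rw [h2] at h1
    have h3 := bin_mul_eq_one 1 1
    rw [show bin 1 1 = (1 + X) * (1 - X) by simp [bin]] at h3
    calc p = ((1 + X) * (1 - X) * bin (-1) (-1)) * p := by rw [h3, one_mul]
      _ = bin (-1) (-1) * ((1 + X) * ((1 - X) * p)) := by ring
      _ = _ := by rw [h1, bin_mul_bin]; congr 1 <;> ring
  induction d with
  | zero =>
    rw [Nat.zero_add, Nat.cast_one]
    refine (key 0 _ _ (step _ (fun m => if m = 0 then 1 else 0) ?_ ?_ ?_) ?_).symm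
    · intro m; simp [Nat.even_add]
    · simp
    · simp
    · ext m; simp [coeff_one]
  | succ d ih =>
    rw [Nat.cast_add_one (d + 1)]
    refine (key (d + 1 : ℕ) _ _ (step _ _ ?_ ?_ ?_) ih.symm).symm
    · intro m
      by_cases hm : Even m
      · have h := Nat.choose_succ_succ (d + 1 + m / 2) d
        simp only [Nat.even_add, hm, even_two, if_true,
          Nat.add_div_right m two_pos]
        rw [show d + 1 + (m / 2 + 1) = d + 1 + m / 2 + 1 by ring,
          show d + (m / 2 + 1) = d + 1 + m / 2 by ring, h]
        push_cast; ring
      · simp [Nat.even_add, hm]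
    · simp
    · simp

end PowerSeries

/-! ### Characters of 𝔽₂ⁿ and the cardinality of the dual code -/

namespace BinaryCode

open Finset

variable {n : ℕ}

/-- The finite set of words of a binary code. -/
noncomputable def words (D : Code n) : Finset (Fin n → ZMod 2) :=
  (D : Set (Fin n → ZMod 2)).toFinite.toFinset

@[simp] lemma mem_words {D : Code n} {c : Fin n → ZMod 2} : c ∈ words D ↔ c ∈ D := by
  simp [words]

/-- The nontrivial character of `𝔽₂`, with complex values. -/
noncomputable def sgn (t : ZMod 2) : ℂ := if t = 0 then 1 else -1

/-- The quadratic refinement `t ↦ i ^ t` of the character `sgn`. -/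
noncomputable def quarter (t : ZMod 2) : ℂ := if t = 0 then 1 else Complex.I

lemma zmod_two_cases (t : ZMod 2) : t = 0 ∨ t = 1 := by
  revert t; decide

@[simp] lemma sgn_zero : sgn 0 = 1 := by simp [sgn]

@[simp] lemma sgn_one : sgn 1 = -1 := by simp [sgn]

lemma sgn_add (s t : ZMod 2) : sgn (s + t) = sgn s * sgn t := by
  have h : (1 + 1 : ZMod 2) = 0 := by decide
  rcases zmod_two_cases s with rfl | rfl <;> rcases zmod_two_cases t with rfl | rfl <;> simp [h]

lemma sgn_sum {ι : Type*} (s : Finset ι) (f : ι → ZMod 2) :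
    sgn (∑ i ∈ s, f i) = ∏ i ∈ s, sgn (f i) := by
  classical
  induction s using Finset.induction_on with
  | empty => simp
  | insert a s ha ih => rw [sum_insert ha, prod_insert ha, sgn_add, ih]

lemma quarter_add (s t : ZMod 2) : quarter (s + t) = quarter s * quarter t * sgn (s * t) := by
  have h : (1 + 1 : ZMod 2) = 0 := by decide
  rcases zmod_two_cases s with rfl | rfl <;> rcases zmod_two_cases t with rfl | rfl <;>
    simp [h, quarter]

lemma prod_ite_eq_pow_hammingNorm {R : Type*} [CommRing R] (v : Fin n → ZMod 2) (x y : R) :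
    ∏ i, (if v i = 0 then x else y) = x ^ (n - hammingNorm v) * y ^ hammingNorm v := by
  rw [Finset.prod_ite, prod_const, prod_const]
  have h := Finset.card_filter_add_card_filter_not (s := (univ : Finset (Fin n))) (fun i => v i = 0)
  simp only [card_univ, Fintype.card_fin] at h
  have h2 : hammingNorm v = #{i | ¬ v i = 0} := rfl
  rw [h2]
  congr 2
  omega

lemma hammingNorm_le (v : Fin n → ZMod 2) : hammingNorm v ≤ n := by
  simpa using hammingNorm_le_card_fintype (x := v)

/-- The generating function of a character of `𝔽₂ⁿ`. -/
lemma sum_pow_mul_sgn (c : Fin n → ZMod 2) (x y : ℂ) :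
    ∑ v : Fin n → ZMod 2, x ^ (n - hammingNorm v) * y ^ hammingNorm v * sgn (v ⬝ᵥ c) =
      (x + y) ^ (n - hammingNorm c) * (x - y) ^ hammingNorm c := by
  have h1 : ∀ v : Fin n → ZMod 2,
      x ^ (n - hammingNorm v) * y ^ hammingNorm v * sgn (v ⬝ᵥ c) =
        ∏ i, ((if v i = 0 then x else y) * sgn (v i * c i)) := by
    intro v
    rw [prod_mul_distrib, prod_ite_eq_pow_hammingNorm, dotProduct, sgn_sum]
  simp_rw [h1]
  have h2 := Finset.prod_univ_sum (fun _ : Fin n => (univ : Finset (ZMod 2)))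
    (fun i t => (if t = 0 then x else y) * sgn (t * c i))
  rw [Fintype.piFinset_univ] at h2
  rw [← h2, ← prod_ite_eq_pow_hammingNorm]
  refine prod_congr rfl fun i _ => ?_
  have h3 : (univ : Finset (ZMod 2)) = {0, 1} := by decide
  rw [h3, sum_pair (by decide)]
  rcases zmod_two_cases (c i) with h | h <;> simp [h, sub_eq_add_neg]

/-- A function that is multiplicative on a code and not identically `1` on it sums to `0`. -/
lemma sum_words_eq_zero {D : Code n} {f : (Fin n → ZMod 2) → ℂ}
    (hf : ∀ c ∈ D, ∀ d ∈ D, f (c + d) = f c * f d) {d : Fin n → ZMod 2} (hd : d ∈ D)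
    (h : f d ≠ 1) : ∑ c ∈ words D, f c = 0 := by
  have h1 : ∑ c ∈ words D, f (c + d) = ∑ c ∈ words D, f c := by
    refine Finset.sum_bij' (fun c _ => c + d) (fun c _ => c - d) ?_ ?_ ?_ ?_ ?_ <;>
      simp +contextual [D.add_mem, D.sub_mem, hd]
  have h2 : ∑ c ∈ words D, f (c + d) = (∑ c ∈ words D, f c) * f d := by
    rw [sum_mul]
    exact sum_congr rfl fun c hc => hf c (mem_words.1 hc) d hd
  have h3 : (∑ c ∈ words D, f c) * (f d - 1) = 0 := by
    rw [mul_sub, ← h2, h1]; ring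
  exact (mul_eq_zero.1 h3).resolve_right (sub_ne_zero.2 h)

lemma mem_dual {D : Code n} {v : Fin n → ZMod 2} : v ∈ dual D ↔ ∀ c ∈ D, v ⬝ᵥ c = 0 := Iff.rfl

open scoped Classical in
lemma sum_words_sgn (D : Code n) (v : Fin n → ZMod 2) :
    ∑ c ∈ words D, sgn (v ⬝ᵥ c) = if v ∈ dual D then (#(words D) : ℂ) else 0 := by
  split_ifs with h
  · rw [sum_congr rfl fun c hc => by rw [h c (mem_words.1 hc), sgn_zero]]
    simp
  · rw [mem_dual] at h
    push Not at h
    obtain ⟨d, hd, hvd⟩ := h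
    refine sum_words_eq_zero (fun c _ d _ => by rw [dotProduct_add, sgn_add]) hd ?_
    rw [(zmod_two_cases _).resolve_left hvd, sgn_one]
    norm_num

/-- Sum (-1)^(v·c) over all v and all c in D in both orders; only c = 0 survives in one of them. -/
lemma card_words_mul_card_words_dual (D : Code n) : #(words D) * #(words (dual D)) = 2 ^ n := by
  classical
  have h1 : ∑ v, ∑ c ∈ words D, sgn (v ⬝ᵥ c) = (#(words D) * #(words (dual D)) : ℂ) := by
    simp_rw [sum_words_sgn]
    rw [← Finset.sum_filter, sum_const, nsmul_eq_mul, mul_comm]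
    congr 3
    ext v; simp
  rw [sum_comm] at h1
  have h2 : ∀ c : Fin n → ZMod 2, ∑ v, sgn (v ⬝ᵥ c) = if c = 0 then 2 ^ n else 0 := by
    intro c
    have h := sum_pow_mul_sgn c 1 1
    simp only [one_pow, one_mul, sub_self] at h
    rw [h]
    split_ifs with hc
    · simp [hc]; norm_num
    · rw [zero_pow (by simpa using hc), mul_zero]
  simp_rw [h2] at h1
  rw [sum_ite_eq' (words D) 0, if_pos (by simp [D.zero_mem])] at h1
  exact_mod_cast h1.symm

lemma card_words (D : Code n) : #(words D) = 2 ^ Module.finrank (ZMod 2) D := by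
  have h : #(words D) = Nat.card D := by
    rw [words, ← Set.ncard_eq_toFinset_card]; rfl
  rw [h, Module.natCard_eq_pow_finrank (K := ZMod 2)]
  simp

namespace IsSemiSelfDual

variable {D : Code n}

lemma card_words_dual (hD : IsSemiSelfDual D) : #(words (dual D)) = 4 * #(words D) := by
  have h := Submodule.finrank_quotient_add_finrank (D.submoduleOf (dual D))
  rw [hD.finrank_quotient] at h
  have h2 : Module.finrank (ZMod 2) (D.submoduleOf (dual D)) = Module.finrank (ZMod 2) D :=
    (Submodule.submoduleOfEquivOfLe hD.self_orthogonal).finrank_eq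
  rw [card_words, card_words, ← h, h2, pow_add]
  norm_num

/-- The length of a semi self-dual code is even and positive. -/
lemma exists_length (hD : IsSemiSelfDual D) : ∃ N, 0 < N ∧ n = 2 * N ∧
    2 * #(words D) = 2 ^ N := by
  have h := card_words_mul_card_words_dual D
  rw [hD.card_words_dual, card_words] at h
  refine ⟨Module.finrank (ZMod 2) D + 1, by omega, ?_, by rw [card_words, pow_succ]; ring⟩
  refine Nat.pow_right_injective le_rfl (?_ : 2 ^ n = 2 ^ _)
  rw [← h]; ring

end IsSemiSelfDual

end BinaryCode

/-! ### Twisted characters, the shadow and Gauss sums -/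

namespace BinaryCode

open Finset

variable {n : ℕ}

/-- The character `c ↦ i ^ wt(c) * (-1) ^ (v ⬝ c)`, multiplicative on self-orthogonal codes. -/
noncomputable def twist (v c : Fin n → ZMod 2) : ℂ := Complex.I ^ hammingNorm c * sgn (v ⬝ᵥ c)

lemma I_pow_hammingNorm (c : Fin n → ZMod 2) :
    Complex.I ^ hammingNorm c = ∏ i, quarter (c i) := by
  have h := prod_ite_eq_pow_hammingNorm c (1 : ℂ) Complex.I
  rw [one_pow, one_mul] at h
  exact h.symm

lemma twist_add (v c d : Fin n → ZMod 2) :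
    twist v (c + d) = twist v c * twist v d * sgn (c ⬝ᵥ d) := by
  have h : Complex.I ^ hammingNorm (c + d) =
      Complex.I ^ hammingNorm c * Complex.I ^ hammingNorm d * sgn (c ⬝ᵥ d) := by
    simp only [I_pow_hammingNorm, dotProduct, sgn_sum, ← prod_mul_distrib]
    exact prod_congr rfl fun i _ => quarter_add _ _
  rw [twist, twist, twist, h, dotProduct_add, sgn_add]
  ring

lemma sgn_one_dotProduct (c : Fin n → ZMod 2) : sgn (c ⬝ᵥ 1) = (-1) ^ hammingNorm c := by
  have h := prod_ite_eq_pow_hammingNorm c (1 : ℂ) (-1)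
  rw [one_pow, one_mul] at h
  rw [← h, dotProduct, sgn_sum]
  simp [sgn]

/-- The words `v` whose twist is trivial on the code. For a code that is not doubly-even this
is the shadow. -/
def InShadow (D : Code n) (v : Fin n → ZMod 2) : Prop := ∀ c ∈ D, twist v c = 1

/-- MacWilliams-type identity for the twists. -/
lemma sum_pow_mul_sum_twist (S : Finset (Fin n → ZMod 2)) (y : ℂ) :
    ∑ v, (1 - Complex.I * y) ^ (n - hammingNorm v) * (1 + Complex.I * y) ^ hammingNorm v *
      ∑ c ∈ S, twist v c = 2 ^ n * ∑ c ∈ S, y ^ hammingNorm c := by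
  simp_rw [mul_sum]
  rw [sum_comm]
  refine sum_congr rfl fun c _ => ?_
  have h := sum_pow_mul_sgn c (1 - Complex.I * y) (1 + Complex.I * y)
  have h1 : ∀ v : Fin n → ZMod 2,
      (1 - Complex.I * y) ^ (n - hammingNorm v) * (1 + Complex.I * y) ^ hammingNorm v * twist v c =
      Complex.I ^ hammingNorm c * ((1 - Complex.I * y) ^ (n - hammingNorm v) *
        (1 + Complex.I * y) ^ hammingNorm v * sgn (v ⬝ᵥ c)) := by
    intro v; rw [twist]; ring
  simp_rw [h1]
  rw [← mul_sum, h, show (1 - Complex.I * y + (1 + Complex.I * y)) = 2 by ring,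
    show (1 - Complex.I * y - (1 + Complex.I * y)) = -Complex.I * (2 * y) by ring, mul_pow, mul_pow]
  have h2 : Complex.I ^ hammingNorm c * (-Complex.I) ^ hammingNorm c = 1 := by
    rw [← mul_pow]; simp
  rw [← pow_sub_mul_pow (2 : ℂ) (hammingNorm_le c)]
  linear_combination (2 ^ (n - hammingNorm c) * (2 ^ hammingNorm c * y ^ hammingNorm c)) * h2

namespace IsSemiSelfDual

variable {D : Code n}

lemma even_hammingNorm (hD : IsSemiSelfDual D) {c : Fin n → ZMod 2} (hc : c ∈ dual D) :
    Even (hammingNorm c) := by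
  have h := sgn_one_dotProduct c
  rw [mem_dual.1 hc 1 hD.one_mem, sgn_zero] at h
  by_contra h2
  rw [(Nat.not_even_iff_odd.1 h2).neg_one_pow] at h
  norm_num at h

lemma twist_add_of_mem (v : Fin n → ZMod 2) {c d : Fin n → ZMod 2}
    (hc : c ∈ dual D) (hd : d ∈ D) : twist v (c + d) = twist v c * twist v d := by
  rw [twist_add, mem_dual.1 hc d hd, sgn_zero, mul_one]

lemma sum_twist_of_not_inShadow (hD : IsSemiSelfDual D) {v : Fin n → ZMod 2}
    (hv : ¬ InShadow D v) : ∑ c ∈ words D, twist v c = 0 := by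
  rw [InShadow] at hv
  push Not at hv
  obtain ⟨d, hd, h⟩ := hv
  exact sum_words_eq_zero
    (fun c hc d hd => twist_add_of_mem v (hD.self_orthogonal hc) hd) hd h

/-- The twist need not be multiplicative on the dual, but it is so under translation by words of D,
which suffices. -/
lemma sum_dual_twist_of_not_inShadow (hD : IsSemiSelfDual D) {v : Fin n → ZMod 2}
    (hv : ¬ InShadow D v) : ∑ c ∈ words (dual D), twist v c = 0 := by
  rw [InShadow] at hv
  push Not at hv
  obtain ⟨d, hd, h⟩ := hv
  have hd' := hD.self_orthogonal hd
  have h1 : ∑ c ∈ words (dual D), twist v (c + d) = ∑ c ∈ words (dual D), twist v c := by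
    refine Finset.sum_bij' (fun c _ => c + d) (fun c _ => c - d) ?_ ?_ ?_ ?_ ?_ <;>
      simp +contextual [(dual D).add_mem, (dual D).sub_mem, hd']
  have h2 : ∑ c ∈ words (dual D), twist v (c + d) =
      (∑ c ∈ words (dual D), twist v c) * twist v d := by
    rw [sum_mul]
    exact sum_congr rfl fun c hc => twist_add_of_mem v (mem_words.1 hc) hd
  have h3 : (∑ c ∈ words (dual D), twist v c) * (twist v d - 1) = 0 := by
    rw [mul_sub, ← h2, h1]; ring
  exact (mul_eq_zero.1 h3).resolve_right (sub_ne_zero.2 h)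

lemma sum_twist_of_inShadow {v : Fin n → ZMod 2}
    (hv : InShadow D v) : ∑ c ∈ words D, twist v c = #(words D) := by
  rw [sum_congr rfl fun c hc => hv c (mem_words.1 hc)]
  simp

/-- The Gauss sum over the dual code equals the Gauss sum over the whole space. -/
lemma sum_dual_twist_of_inShadow (D : Code n) {v : Fin n → ZMod 2} (hv : InShadow D v) :
    ∑ c ∈ words (dual D), twist v c =
      (1 + Complex.I) ^ (n - hammingNorm v) * (1 - Complex.I) ^ hammingNorm v := by
  classical
  have h0 : ∑ c, twist v c =
      (1 + Complex.I) ^ (n - hammingNorm v) * (1 - Complex.I) ^ hammingNorm v := by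
    rw [← sum_pow_mul_sgn]
    refine sum_congr rfl fun c _ => ?_
    rw [twist, one_pow, one_mul, dotProduct_comm]
  have h1 : ∀ d : Fin n → ZMod 2, ∑ c, twist v (c + d) = ∑ c, twist v c := fun d =>
    Fintype.sum_equiv (Equiv.addRight d) _ _ fun _ => rfl
  -- Averaging the full sum over translates by D: the inner character sum kills every c outside the
  -- dual.
  have h2 : ∑ d ∈ words D, ∑ c, twist v (c + d) = #(words D) * ∑ c, twist v c := by
    simp_rw [h1]; simp
  rw [sum_comm] at h2
  have h3 : ∀ c, ∑ d ∈ words D, twist v (c + d) =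
      twist v c * if c ∈ dual D then (#(words D) : ℂ) else 0 := by
    intro c
    rw [← sum_words_sgn, mul_sum]
    refine sum_congr rfl fun d hd => ?_
    rw [twist_add, hv d (mem_words.1 hd), mul_one]
  simp_rw [h3, mul_ite, mul_zero] at h2
  rw [← sum_filter, ← sum_mul, mul_comm] at h2
  have h4 : ({c | c ∈ dual D} : Finset (Fin n → ZMod 2)) = words (dual D) := by ext; simp
  have h5 : (#(words D) : ℂ) ≠ 0 := by
    simp [card_words]
  rw [h4] at h2
  rw [← h0]
  exact mul_left_cancel₀ h5 h2

end IsSemiSelfDual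

lemma one_add_I_pow_mul {N w : ℕ} (hw : w ≤ 2 * N) :
    (1 + Complex.I) ^ (2 * N - w) * (1 - Complex.I) ^ w = 2 ^ N * Complex.I ^ (N + 3 * w) := by
  have h1 : (1 - Complex.I) = (1 + Complex.I) * Complex.I ^ 3 := by
    rw [Complex.I_pow_three]; linear_combination Complex.I_sq
  have h2 : (1 + Complex.I) ^ 2 = 2 * Complex.I := by linear_combination Complex.I_sq
  rw [h1, mul_pow, ← mul_assoc, ← pow_add, Nat.sub_add_cancel hw, pow_mul, h2, mul_pow, ← pow_mul,
    mul_assoc, ← pow_add]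

lemma im_twist_eq_zero {v c : Fin n → ZMod 2} (hc : Even (hammingNorm c)) :
    (twist v c).im = 0 := by
  obtain ⟨k, hk⟩ := hc
  rw [twist, hk, ← two_mul, pow_mul, Complex.I_sq]
  rcases zmod_two_cases (v ⬝ᵥ c) with h | h <;> rcases neg_one_pow_eq_or ℂ k with h' | h' <;>
    simp [h, h']

/-- The Gauss sum is 2^N I^(N + 3 wt v). Dual words have even weight, so it is real; this excludes
odd exponents, and its sign determines wt v mod 4. -/
lemma IsSemiSelfDual.sum_dual_twist {N : ℕ} {D : Code (2 * N)} (hD : IsSemiSelfDual D)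
    {v : Fin (2 * N) → ZMod 2} (hv : InShadow D v) :
    (hammingNorm v % 4 = N % 4 ∧ ∑ c ∈ words (dual D), twist v c = 2 ^ N) ∨
    (hammingNorm v % 4 = (N + 2) % 4 ∧ ∑ c ∈ words (dual D), twist v c = -2 ^ N) := by
  have h1 := sum_dual_twist_of_inShadow D hv
  rw [one_add_I_pow_mul (hammingNorm_le v)] at h1
  have h2 : (∑ c ∈ words (dual D), twist v c).im = 0 := by
    rw [Complex.im_sum]
    exact sum_eq_zero fun c hc => im_twist_eq_zero (hD.even_hammingNorm (mem_words.1 hc))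
  have h3 := h1
  rw [← Nat.div_add_mod (N + 3 * hammingNorm v) 4, pow_add, pow_mul, Complex.I_pow_four, one_pow,
    one_mul] at h3
  have h4 : (N + 3 * hammingNorm v) % 4 < 4 := Nat.mod_lt _ (by norm_num)
  have h5 : (2 : ℂ) ^ N = ((2 ^ N : ℝ) : ℂ) := by push_cast; rfl
  have h6 : (2 : ℝ) ^ N ≠ 0 := by positivity
  interval_cases h : (N + 3 * hammingNorm v) % 4
  · left; exact ⟨by omega, by simpa using h3⟩
  · rw [h3, pow_one, h5] at h2
    simp [-Complex.ofReal_pow] at h2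
  · right; exact ⟨by omega, by simpa using h3⟩
  · rw [h3, Complex.I_pow_three, h5] at h2
    simp [-Complex.ofReal_pow] at h2

end BinaryCode

/-! ### Power sums in terms of a product and a squared difference -/

section PowerSums

open Finset

variable {R : Type*} [CommRing R]

/-- `∑ᵢ C(l + i, 2 i) F ^ (l - i) G ^ i`. -/
def morganVoyceEven (F G : R) (l : ℕ) : R :=
  ∑ i ∈ range (l + 1), ((l + i).choose (2 * i) : R) * F ^ (l - i) * G ^ i

/-- `∑ᵢ C(l + i + 1, 2 i + 1) F ^ (l - i) G ^ i`. -/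
def morganVoyceOdd (F G : R) (l : ℕ) : R :=
  ∑ i ∈ range (l + 1), ((l + i + 1).choose (2 * i + 1) : R) * F ^ (l - i) * G ^ i

lemma sum_mul_pow_sub (F G : R) (l : ℕ) (c : ℕ → R) (hc : c (l + 1) = 0) :
    ∑ i ∈ range (l + 2), c i * F ^ (l + 1 - i) * G ^ i =
      F * ∑ i ∈ range (l + 1), c i * F ^ (l - i) * G ^ i := by
  rw [sum_range_succ, hc, mul_sum, zero_mul, zero_mul, add_zero]
  refine sum_congr rfl fun i hi => ?_
  rw [Nat.succ_sub (Nat.lt_succ_iff.1 (mem_range.1 hi)), pow_succ]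
  ring

lemma morganVoyceEven_succ (F G : R) (l : ℕ) :
    morganVoyceEven F G (l + 1) = F * morganVoyceEven F G l + G * morganVoyceOdd F G l := by
  have h1 := sum_mul_pow_sub F G l (fun i => ((l + i).choose (2 * i) : R))
    (by rw [Nat.choose_eq_zero_of_lt (by omega), Nat.cast_zero])
  rw [morganVoyceEven, morganVoyceEven, morganVoyceOdd, ← h1, sum_range_succ' _ (l + 1), mul_sum,
    sum_range_succ' _ (l + 1), add_right_comm (∑ _ ∈ _, _), ← sum_add_distrib]
  congr 1
  · refine sum_congr rfl fun i _ => ?_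
    rw [show l + 1 + (i + 1) = l + (i + 1) + 1 by ring, show 2 * (i + 1) = 2 * i + 1 + 1 by ring,
      Nat.choose_succ_succ, Nat.add_sub_add_right]
    push_cast
    rw [show l + i + 1 = l + (i + 1) by ring]
    ring
  · simp

lemma morganVoyceOdd_succ (F G : R) (l : ℕ) :
    morganVoyceOdd F G (l + 1) = F * morganVoyceOdd F G l + morganVoyceEven F G (l + 1) := by
  have h1 := sum_mul_pow_sub F G l (fun i => ((l + i + 1).choose (2 * i + 1) : R))
    (by rw [Nat.choose_eq_zero_of_lt (by omega), Nat.cast_zero])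
  rw [morganVoyceOdd, morganVoyceOdd, ← h1, morganVoyceEven, ← sum_add_distrib]
  refine sum_congr rfl fun i _ => ?_
  rw [Nat.choose_succ_succ, show l + 1 + i = l + i + 1 by ring]
  push_cast; ring

/-- The three formulas are proved together because each induction step for one uses the others. -/
lemma pow_add_pow_morganVoyce (a b : R) (l : ℕ) :
    a ^ (2 * l + 1) + b ^ (2 * l + 1) = (a + b) * morganVoyceEven (a * b) ((a - b) ^ 2) l ∧
    a ^ (2 * l + 2) - b ^ (2 * l + 2) = (a ^ 2 - b ^ 2) * morganVoyceOdd (a * b) ((a - b) ^ 2) l ∧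
    a ^ (2 * l + 2) + b ^ (2 * l + 2) = morganVoyceEven (a * b) ((a - b) ^ 2) (l + 1) +
      a * b * morganVoyceEven (a * b) ((a - b) ^ 2) l := by
  induction l with
  | zero => simp [morganVoyceEven, morganVoyceOdd, sum_range_succ]; ring
  | succ l ih =>
    obtain ⟨h1, h2, h3⟩ := ih
    have h4 : a ^ (2 * (l + 1) + 1) + b ^ (2 * (l + 1) + 1) =
        (a + b) * morganVoyceEven (a * b) ((a - b) ^ 2) (l + 1) := by
      rw [morganVoyceEven_succ]
      linear_combination a * b * h1 + (a - b) * h2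
    have h5 : a ^ (2 * (l + 1) + 2) - b ^ (2 * (l + 1) + 2) =
        (a ^ 2 - b ^ 2) * morganVoyceOdd (a * b) ((a - b) ^ 2) (l + 1) := by
      rw [morganVoyceOdd_succ]
      linear_combination a * b * h2 + (a - b) * h4
    refine ⟨h4, h5, ?_⟩
    have h6 := morganVoyceEven_succ (a * b) ((a - b) ^ 2) l
    have h7 := morganVoyceOdd_succ (a * b) ((a - b) ^ 2) l
    rw [morganVoyceEven_succ _ _ (l + 1), h7]
    linear_combination (a + b) * h4 - a * b * h3 + a * b * h6

/-- `∑ᵢ (C(l + i, 2 i) + C(l + i - 1, 2 i)) F ^ (l - i) G ^ i`. -/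
def lucasSum (F G : R) (l : ℕ) : R :=
  ∑ i ∈ range (l + 1), (((l + i).choose (2 * i) + (l + i - 1).choose (2 * i) : ℕ) : R) *
    F ^ (l - i) * G ^ i

lemma pow_add_pow_lucasSum (a b : R) (l : ℕ) :
    a ^ (2 * l) + b ^ (2 * l) = lucasSum (a * b) ((a - b) ^ 2) l := by
  rcases l with _ | l
  -- Truncated subtraction gives `(0 - 1).choose 0 = 1`, so the sum is 2, as required.
  · simp [lucasSum]
  · have h1 := sum_mul_pow_sub (a * b) ((a - b) ^ 2) l (fun i => ((l + i).choose (2 * i) : R))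
      (by rw [Nat.choose_eq_zero_of_lt (by omega), Nat.cast_zero])
    rw [show 2 * (l + 1) = 2 * l + 2 by ring, (pow_add_pow_morganVoyce a b l).2.2, morganVoyceEven,
      morganVoyceEven, ← h1, ← sum_add_distrib, lucasSum]
    refine sum_congr rfl fun i _ => ?_
    rw [show l + 1 + i - 1 = l + i by omega]
    push_cast; ring

end PowerSums

/-! ### Expansion of the weight enumerators over the shadow -/

namespace BinaryCode

open Finset Polynomial

/-- The distance of a weight from half of the length `2 * N`, divided by four. -/
def level (N w : ℕ) : ℕ := (N - w + (w - N)) / 4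

/-- Expansion of a self-conjugate pair of monomials with `N - w ≡ 2 mod 4`. -/
noncomputable def oddTerm (N l : ℕ) : ℤ[X] :=
  ∑ j ∈ range (l + 1), ((l + j).choose (2 * j) * (-64) ^ j : ℤ) •
    ((1 - 6 * X + X ^ 2) * (X * (1 - X) ^ 2) ^ j * (1 + X) ^ (N - 2 - 4 * j))

/-- Expansion of a self-conjugate pair of monomials with `N - w ≡ 0 mod 4`. -/
noncomputable def evenTerm (N l : ℕ) : ℤ[X] :=
  ∑ j ∈ range (l + 1), (((l + j).choose (2 * j) + (l + j - 1).choose (2 * j) : ℕ) * (-64) ^ j : ℤ) •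
    ((X * (1 - X) ^ 2) ^ j * (1 + X) ^ (N - 4 * j))

lemma monomial_pair {R : Type*} [CommRing R] {N w m : ℕ} (a b : R)
    (h : w + m = N ∨ w = N + m) (hw : w ≤ 2 * N) :
    a ^ (2 * N - w) * b ^ w + b ^ (2 * N - w) * a ^ w =
      (a * b) ^ (N - m) * (a ^ (2 * m) + b ^ (2 * m)) := by
  rcases h with h | h
  · rw [show 2 * N - w = N - m + 2 * m by omega, show w = N - m by omega]; ring
  · rw [show 2 * N - w = N - m by omega, show w = N - m + 2 * m by omega]; ring

/-- Apply the power sums to a = (1 - iy)⁴, b = (1 + iy)⁴: here ab = (1 + y²)⁴ and (a - b)² = -64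
y²(1 - y²)², the source of -64 and of X(1-X)². The factor a + b = 2(1 - 6y² + y⁴) comes from the odd
exponent. -/
lemma pair_eq_aeval_oddTerm {N w : ℕ} (hw : w ≤ 2 * N) (hmod : w % 4 = (N + 2) % 4) (y : ℂ) :
    (1 - Complex.I * y) ^ (2 * N - w) * (1 + Complex.I * y) ^ w +
      (1 + Complex.I * y) ^ (2 * N - w) * (1 - Complex.I * y) ^ w =
      2 * aeval (y ^ 2) (oddTerm N (level N w)) := by
  set l := level N w with hl
  have h : w + (4 * l + 2) = N ∨ w = N + (4 * l + 2) := by rw [hl, level]; omega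
  have hI := Complex.I_sq
  rw [monomial_pair _ _ h hw,
    show (1 - Complex.I * y) * (1 + Complex.I * y) = 1 + y ^ 2 by linear_combination -y ^ 2 * hI,
    show 2 * (4 * l + 2) = 4 * (2 * l + 1) by ring, pow_mul, pow_mul (1 + Complex.I * y) 4,
    (pow_add_pow_morganVoyce _ _ l).1, morganVoyceEven, oddTerm, map_sum]
  have h1 : (1 - Complex.I * y) ^ 4 + (1 + Complex.I * y) ^ 4 = 2 * (1 - 6 * y ^ 2 + (y ^ 2) ^ 2) := by
    linear_combination (12 * y ^ 2 + 2 * y ^ 4 * (Complex.I ^ 2 - 1)) * hI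
  have h2 : (1 - Complex.I * y) ^ 4 * (1 + Complex.I * y) ^ 4 = (1 + y ^ 2) ^ 4 := by
    rw [← mul_pow]; congr 1; linear_combination -y ^ 2 * hI
  have h3 : ((1 - Complex.I * y) ^ 4 - (1 + Complex.I * y) ^ 4) ^ 2 =
      -64 * (y ^ 2 * (1 - y ^ 2) ^ 2) := by
    have : (1 - Complex.I * y) ^ 4 - (1 + Complex.I * y) ^ 4 = -8 * Complex.I * (y * (1 - y ^ 2)) := by
      linear_combination (-8 * Complex.I * y ^ 3) * hI
    rw [this]
    linear_combination 64 * (y * (1 - y ^ 2)) ^ 2 * hI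
  rw [h1, h2, h3, mul_sum, mul_sum, mul_sum]
  refine sum_congr rfl fun j hj => ?_
  have hj := mem_range.1 hj
  rw [map_zsmul]
  simp only [map_mul, map_pow, map_add, map_sub, map_one, aeval_X, zsmul_eq_mul, map_ofNat]
  rw [show N - 2 - 4 * j = N - (4 * l + 2) + 4 * (l - j) by omega, pow_add, pow_mul (1 + y ^ 2) 4,
    mul_pow (-64 : ℂ)]
  push_cast
  ring

lemma pair_eq_aeval_evenTerm {N w : ℕ} (hw : w ≤ 2 * N) (hmod : w % 4 = N % 4) (y : ℂ) :
    (1 - Complex.I * y) ^ (2 * N - w) * (1 + Complex.I * y) ^ w +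
      (1 + Complex.I * y) ^ (2 * N - w) * (1 - Complex.I * y) ^ w =
      aeval (y ^ 2) (evenTerm N (level N w)) := by
  set l := level N w with hl
  have h : w + 4 * l = N ∨ w = N + 4 * l := by rw [hl, level]; omega
  have hI := Complex.I_sq
  rw [monomial_pair _ _ h hw,
    show (1 - Complex.I * y) * (1 + Complex.I * y) = 1 + y ^ 2 by linear_combination -y ^ 2 * hI,
    show 2 * (4 * l) = 4 * (2 * l) by ring, pow_mul, pow_mul (1 + Complex.I * y) 4,
    pow_add_pow_lucasSum, lucasSum, evenTerm, map_sum]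
  have h2 : (1 - Complex.I * y) ^ 4 * (1 + Complex.I * y) ^ 4 = (1 + y ^ 2) ^ 4 := by
    rw [← mul_pow]; congr 1; linear_combination -y ^ 2 * hI
  have h3 : ((1 - Complex.I * y) ^ 4 - (1 + Complex.I * y) ^ 4) ^ 2 =
      -64 * (y ^ 2 * (1 - y ^ 2) ^ 2) := by
    have : (1 - Complex.I * y) ^ 4 - (1 + Complex.I * y) ^ 4 = -8 * Complex.I * (y * (1 - y ^ 2)) := by
      linear_combination (-8 * Complex.I * y ^ 3) * hI
    rw [this]
    linear_combination 64 * (y * (1 - y ^ 2)) ^ 2 * hI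
  rw [h2, h3, mul_sum]
  refine sum_congr rfl fun j hj => ?_
  have hj := mem_range.1 hj
  rw [map_zsmul]
  simp only [map_mul, map_pow, map_add, map_sub, map_one, aeval_X, zsmul_eq_mul]
  rw [show N - 4 * j = N - (4 * l) + 4 * (l - j) by omega, pow_add, pow_mul (1 + y ^ 2) 4,
    mul_pow (-64 : ℂ)]
  push_cast
  ring

lemma eq_of_forall_aeval_sq {p q : ℤ[X]} (h : ∀ y : ℂ, aeval (y ^ 2) p = aeval (y ^ 2) q) :
    p = q := by
  refine map_injective (Int.castRingHom ℂ) Int.cast_injective (funext fun z => ?_)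
  obtain ⟨y, rfl⟩ := IsAlgClosed.exists_pow_nat_eq z two_pos
  simpa [aeval_def, eval_map] using h y

/-- The weight enumerator of an even code, with `X ^ 2` replaced by `X`. -/
noncomputable def halfEnum {n : ℕ} (D : Code n) : ℤ[X] :=
  ∑ c ∈ words D, X ^ (hammingNorm c / 2)

lemma aeval_halfEnum {n : ℕ} {D : Code n} (hD : ∀ c ∈ D, Even (hammingNorm c)) (y : ℂ) :
    aeval (y ^ 2) (halfEnum D) = ∑ c ∈ words D, y ^ hammingNorm c := by
  rw [halfEnum, map_sum]
  refine sum_congr rfl fun c hc => ?_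
  rw [map_pow, aeval_X, ← pow_mul, Nat.mul_div_cancel' (hD c (mem_words.1 hc)).two_dvd]

open scoped Classical in
/-- The words of the shadow whose weight is congruent to `r` modulo four. -/
noncomputable def shadowWords {n : ℕ} (D : Code n) (r : ℕ) : Finset (Fin n → ZMod 2) :=
  {v | InShadow D v ∧ hammingNorm v % 4 = r % 4}

lemma mem_shadowWords {n : ℕ} {D : Code n} {r : ℕ} {v : Fin n → ZMod 2} :
    v ∈ shadowWords D r ↔ InShadow D v ∧ hammingNorm v % 4 = r % 4 := by
  simp [shadowWords]

namespace IsSemiSelfDual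

variable {N : ℕ} {D : Code (2 * N)}

/-- On the shadow the two sums, weighted by 2 and ε, are both ±2^N, so they double in one weight
class mod 4 and cancel in the other. -/
lemma sum_twist_add (hD : IsSemiSelfDual D) (hN : 2 * #(words D) = 2 ^ N) {ε : ℤ} {r : ℕ}
    (hε : (ε = -1 ∧ r = N + 2) ∨ (ε = 1 ∧ r = N)) (v : Fin (2 * N) → ZMod 2) :
    2 * ∑ c ∈ words D, twist v c + ε * ∑ c ∈ words (dual D), twist v c =
      if v ∈ shadowWords D r then 2 * 2 ^ N else 0 := by
  have hN' : (2 : ℂ) * #(words D) = 2 ^ N := by exact_mod_cast hN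
  by_cases hv : InShadow D v
  · rw [sum_twist_of_inShadow hv, hN']
    simp only [mem_shadowWords, hv, true_and]
    rcases hD.sum_dual_twist hv with ⟨h1, h2⟩ | ⟨h1, h2⟩ <;>
      rcases hε with ⟨rfl, rfl⟩ | ⟨rfl, rfl⟩ <;> rw [h2]
    · rw [if_neg (by omega)]; push_cast; ring
    · rw [if_pos h1]; push_cast; ring
    · rw [if_pos h1]; push_cast; ring
    · rw [if_neg (by omega)]; push_cast; ring
  · rw [hD.sum_twist_of_not_inShadow hv, hD.sum_dual_twist_of_not_inShadow hv, if_neg]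
    · simp
    · rw [mem_shadowWords]; tauto

lemma aeval_halfEnum_add (hD : IsSemiSelfDual D) (hN : 2 * #(words D) = 2 ^ N) {ε : ℤ} {r : ℕ}
    (hε : (ε = -1 ∧ r = N + 2) ∨ (ε = 1 ∧ r = N)) (y : ℂ) :
    2 ^ N * aeval (y ^ 2) (2 * halfEnum D + ε • halfEnum (dual D)) =
      2 * ∑ v ∈ shadowWords D r,
        (1 - Complex.I * y) ^ (2 * N - hammingNorm v) * (1 + Complex.I * y) ^ hammingNorm v := by
  have h1 := sum_pow_mul_sum_twist (words D) y
  have h2 := sum_pow_mul_sum_twist (words (dual D)) y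
  rw [← aeval_halfEnum fun c hc => hD.even_hammingNorm (hD.self_orthogonal hc)] at h1
  rw [← aeval_halfEnum fun c hc => hD.even_hammingNorm hc] at h2
  have h3 : ∑ v, (1 - Complex.I * y) ^ (2 * N - hammingNorm v) *
      (1 + Complex.I * y) ^ hammingNorm v *
      (2 * ∑ c ∈ words D, twist v c + ε * ∑ c ∈ words (dual D), twist v c) =
      2 ^ (2 * N) * aeval (y ^ 2) (2 * halfEnum D + ε • halfEnum (dual D)) := by
    rw [map_add, map_mul, map_zsmul, map_ofNat, zsmul_eq_mul, mul_add, mul_left_comm,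
      mul_left_comm _ (ε : ℂ), ← h1, ← h2, mul_sum, mul_sum, ← sum_add_distrib]
    refine sum_congr rfl fun v _ => by ring
  simp_rw [hD.sum_twist_add hN hε, mul_ite, mul_zero] at h3
  rw [← sum_filter, filter_mem_eq_inter, univ_inter, ← sum_mul] at h3
  refine mul_left_cancel₀ (pow_ne_zero N (two_ne_zero (α := ℂ))) ?_
  rw [← mul_assoc, ← pow_add, ← two_mul, ← h3]
  ring

lemma two_mul_aeval_halfEnum_add (hD : IsSemiSelfDual D) (hN : 2 * #(words D) = 2 ^ N) {ε : ℤ}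
    {r : ℕ} (hε : (ε = -1 ∧ r = N + 2) ∨ (ε = 1 ∧ r = N)) (y : ℂ) :
    2 ^ N * aeval (y ^ 2) (2 * halfEnum D + ε • halfEnum (dual D)) =
      ∑ v ∈ shadowWords D r,
        ((1 - Complex.I * y) ^ (2 * N - hammingNorm v) * (1 + Complex.I * y) ^ hammingNorm v +
        (1 + Complex.I * y) ^ (2 * N - hammingNorm v) * (1 - Complex.I * y) ^ hammingNorm v) := by
  have h1 := hD.aeval_halfEnum_add hN hε y
  have h2 := hD.aeval_halfEnum_add hN hε (-y)
  simp only [neg_sq, mul_neg, sub_neg_eq_add, ← sub_eq_add_neg] at h2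
  rw [sum_add_distrib]
  linear_combination h1 / 2 + h2 / 2

lemma halfEnum_sub (hD : IsSemiSelfDual D) (hN : 2 * #(words D) = 2 ^ N) :
    2 ^ N * (2 * halfEnum D - halfEnum (dual D)) =
      2 * ∑ v ∈ shadowWords D (N + 2), oddTerm N (level N (hammingNorm v)) := by
  refine eq_of_forall_aeval_sq fun y => ?_
  have h := hD.two_mul_aeval_halfEnum_add hN (ε := -1) (.inl ⟨rfl, rfl⟩) y
  rw [neg_one_zsmul, ← sub_eq_add_neg] at h
  simp only [map_mul, map_pow, map_ofNat, map_sum] at h ⊢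
  rw [h, mul_sum]
  exact sum_congr rfl fun v hv =>
    pair_eq_aeval_oddTerm (hammingNorm_le v) (mem_shadowWords.1 hv).2 y

lemma halfEnum_add (hD : IsSemiSelfDual D) (hN : 2 * #(words D) = 2 ^ N) :
    2 ^ N * (2 * halfEnum D + halfEnum (dual D)) =
      ∑ v ∈ shadowWords D N, evenTerm N (level N (hammingNorm v)) := by
  refine eq_of_forall_aeval_sq fun y => ?_
  have h := hD.two_mul_aeval_halfEnum_add hN (ε := 1) (.inr ⟨rfl, rfl⟩) y
  rw [one_zsmul] at h
  simp only [map_mul, map_pow, map_ofNat, map_sum] at h ⊢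
  rw [h]
  exact sum_congr rfl fun v hv =>
    pair_eq_aeval_evenTerm (hammingNorm_le v) (mem_shadowWords.1 hv).2 y

end IsSemiSelfDual

end BinaryCode

/-! ### Signs of coefficients and biorthogonality -/

namespace PowerSeries

/-- The series is (1+X)^b/(1-X²)^(d+1). For b = 0 only even powers occur; one factor 1 + X fills in
the odd ones. -/
lemma bin_nonneg_and_pos (d b : ℕ) :
    (∀ m, 0 ≤ coeff m (bin (b - (d + 1 : ℕ)) (-(d + 1 : ℕ)))) ∧
    (∀ m, 0 < coeff (2 * m) (bin (b - (d + 1 : ℕ)) (-(d + 1 : ℕ)))) ∧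
    (0 < b → ∀ m, 0 < coeff (2 * m + 1) (bin (b - (d + 1 : ℕ)) (-(d + 1 : ℕ)))) := by
  induction b with
  | zero =>
    rw [Nat.cast_zero, zero_sub, bin_neg_neg]
    refine ⟨fun m => ?_, fun m => ?_, fun h => absurd h (lt_irrefl 0)⟩
    · rw [coeff_mk]; split_ifs <;> positivity
    · rw [coeff_mk, if_pos (even_two_mul m)]
      exact_mod_cast Nat.choose_pos (Nat.le_add_right _ _)
  | succ b ih =>
    obtain ⟨h1, h2, -⟩ := ih
    have h : bin ((b + 1 : ℕ) - (d + 1 : ℕ)) (-(d + 1 : ℕ)) =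
        bin (b - (d + 1 : ℕ)) (-(d + 1 : ℕ)) + X * bin (b - (d + 1 : ℕ)) (-(d + 1 : ℕ)) := by
      rw [← one_add_mul, one_add_X_mul_bin]; congr 1; push_cast; ring
    rw [h]
    simp only [map_add, coeff_succ_X_mul]
    have h3 : ∀ m, 0 ≤ coeff m (X * bin (b - (d + 1 : ℕ)) (-(d + 1 : ℕ))) := by
      rintro (_ | m)
      · simp
      · rw [coeff_succ_X_mul]; exact h1 m
    exact ⟨fun m => add_nonneg (h1 m) (h3 m), fun m => add_pos_of_pos_of_nonneg (h2 m) (h3 _),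
      fun _ m => add_pos_of_nonneg_of_pos (h1 _) (h2 m)⟩

lemma coeff_bin_pos_of_even {a c : ℤ} {d b m : ℕ} (ha : a = b - (d + 1 : ℕ))
    (hc : c = -(d + 1 : ℕ)) : 0 < coeff (2 * m) (bin a c) := by
  subst ha hc; exact (bin_nonneg_and_pos d b).2.1 m

lemma coeff_bin_pos_of_odd {a c : ℤ} {d b m : ℕ} (hb : 0 < b) (ha : a = b - (d + 1 : ℕ))
    (hc : c = -(d + 1 : ℕ)) : 0 < coeff (2 * m + 1) (bin a c) := by
  subst ha hc; exact (bin_nonneg_and_pos d b).2.2 hb m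

lemma coeff_bin_eq_zero_of_odd {a c : ℤ} {d m : ℕ} (ha : a = -(d + 1 : ℕ))
    (hc : c = -(d + 1 : ℕ)) : coeff (2 * m + 1) (bin a c) = 0 := by
  subst ha hc
  rw [bin_neg_neg, coeff_mk, if_neg (by simp)]

/-- The monomials `(X * (1 - X) ^ 2) ^ j * (1 + X) ^ e` are biorthogonal to the functionals
given by `bin`. -/
lemma coeff_monomial_mul_bin {i j e : ℕ} {a : ℤ} (h : e + a = 4 * ((i : ℤ) - j) - 1) :
    coeff i ((1 - 6 * X + X ^ 2) * (X * (1 - X) ^ 2) ^ j * (1 + X) ^ e * bin a (-2 * i - 1)) =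
      if j = i then 1 else 0 := by
  have h1 : (1 - 6 * X + X ^ 2) * (X * (1 - X) ^ 2) ^ j * (1 + X) ^ e * bin a (-2 * i - 1) =
      X ^ j * ((1 - 6 * X + X ^ 2) * bin (4 * ((i : ℤ) - j) - 1) (-2 * ((i : ℤ) - j) - 1)) := by
    rw [show bin (4 * ((i : ℤ) - j) - 1) (-2 * ((i : ℤ) - j) - 1) =
      bin e (2 * j : ℕ) * bin a (-2 * i - 1) by
        rw [bin_mul_bin, h]; congr 1; push_cast; ring, bin_natCast, mul_pow, pow_mul]
    ring
  rw [h1, coeff_X_pow_mul']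
  split_ifs with h2 h3 h3
  · subst h3; simpa using coeff_bin_eq_ite 0
  · have := coeff_bin_eq_ite (i - j)
    rw [if_neg (by omega), Nat.cast_sub h2] at this
    exact this
  · omega
  · rfl

end PowerSeries

/-! ### Extracting the coefficients of the expansions -/

namespace BinaryCode

open Finset PowerSeries

lemma coeff_oddTerm_mul_bin {N l : ℕ} (hl : 4 * l + 2 ≤ N) (i : ℕ) :
    coeff i ((oddTerm N l : ℤ⟦X⟧) * bin (4 * i - N + 1) (-2 * i - 1)) =
      (-64) ^ i * ((l + i).choose (2 * i) : ℤ) := by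
  have h : (oddTerm N l : ℤ⟦X⟧) * bin (4 * i - N + 1) (-2 * i - 1) =
      ∑ j ∈ range (l + 1), ((l + j).choose (2 * j) * (-64) ^ j : ℤ) •
        ((1 - 6 * X + X ^ 2) * (X * (1 - X) ^ 2) ^ j * (1 + X) ^ (N - 2 - 4 * j) *
          bin (4 * i - N + 1) (-2 * i - 1)) := by
    rw [← Polynomial.coeToPowerSeries.ringHom_apply, oddTerm, map_sum, sum_mul]
    refine sum_congr rfl fun j _ => ?_
    rw [map_zsmul, smul_mul_assoc]
    simp only [map_mul, map_pow, map_add, map_sub, map_one, map_ofNat]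
    simp only [Polynomial.coeToPowerSeries.ringHom_apply, Polynomial.coe_X]
  rw [h, map_sum, sum_congr rfl (g := fun j =>
    if j = i then ((l + j).choose (2 * j) * (-64) ^ j : ℤ) else 0)]
  · rw [sum_ite_eq']
    split_ifs with h1
    · ring
    · rw [mem_range] at h1
      -- Outside the range i > l, hence l + i < 2i.
      rw [Nat.choose_eq_zero_of_lt (by omega)]; simp
  · intro j hj
    have := mem_range.1 hj
    rw [map_zsmul, coeff_monomial_mul_bin (by omega), smul_eq_mul, mul_ite, mul_one, mul_zero]

lemma coeff_evenTerm_mul_bin {N l : ℕ} (hl : 4 * l ≤ N) (i : ℕ) :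
    coeff i ((evenTerm N l : ℤ⟦X⟧) * ((1 - 6 * X + X ^ 2) * bin (4 * i - N - 1) (-2 * i - 1))) =
      (-64) ^ i * (((l + i).choose (2 * i) + (l + i - 1).choose (2 * i) : ℕ) : ℤ) := by
  have h : (evenTerm N l : ℤ⟦X⟧) * ((1 - 6 * X + X ^ 2) * bin (4 * i - N - 1) (-2 * i - 1)) =
      ∑ j ∈ range (l + 1),
        (((l + j).choose (2 * j) + (l + j - 1).choose (2 * j) : ℕ) * (-64) ^ j : ℤ) •
        ((1 - 6 * X + X ^ 2) * (X * (1 - X) ^ 2) ^ j * (1 + X) ^ (N - 4 * j) *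
          bin (4 * i - N - 1) (-2 * i - 1)) := by
    rw [← Polynomial.coeToPowerSeries.ringHom_apply, evenTerm, map_sum, sum_mul]
    refine sum_congr rfl fun j _ => ?_
    rw [map_zsmul, smul_mul_assoc]
    congr 1
    simp only [map_mul, map_pow, map_add, map_sub, map_one]
    simp only [Polynomial.coeToPowerSeries.ringHom_apply, Polynomial.coe_X]
    ring
  rw [h, map_sum, sum_congr rfl (g := fun j => if j = i then
    (((l + j).choose (2 * j) + (l + j - 1).choose (2 * j) : ℕ) * (-64) ^ j : ℤ) else 0)]
  · rw [sum_ite_eq']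
    split_ifs with h1
    · ring
    · rw [mem_range] at h1
      rw [Nat.choose_eq_zero_of_lt (by omega), Nat.choose_eq_zero_of_lt (by omega)]; simp
  · intro j hj
    have := mem_range.1 hj
    rw [map_zsmul, coeff_monomial_mul_bin (by omega), smul_eq_mul, mul_ite, mul_one, mul_zero]

/-- Only the zero word contributes to the low order coefficients. -/
lemma coeff_halfEnum_mul {n : ℕ} {D : Code n} {i : ℕ}
    (h : ∀ c ∈ D, c ≠ 0 → i < hammingNorm c / 2) (Q : ℤ⟦X⟧) :
    coeff i ((halfEnum D : ℤ⟦X⟧) * Q) = coeff i Q := by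
  rw [← Polynomial.coeToPowerSeries.ringHom_apply, halfEnum, map_sum, sum_mul, map_sum,
    sum_eq_single 0]
  · simp
  · intro c hc hc0
    have := h c (mem_words.1 hc) hc0
    rw [map_pow, Polynomial.coeToPowerSeries.ringHom_apply, Polynomial.coe_X, coeff_X_pow_mul',
      if_neg (by omega)]
  · intro h0; exact absurd (by simp [D.zero_mem]) h0

lemma level_le_of_odd {N w : ℕ} (hw : w ≤ 2 * N) (h : w % 4 = (N + 2) % 4) :
    4 * level N w + 2 ≤ N := by
  rw [level]; omega

lemma level_le_of_even {N w : ℕ} (hw : w ≤ 2 * N) : 4 * level N w ≤ N := by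
  rw [level]; omega

namespace IsSemiSelfDual

variable {N : ℕ} {D : Code (2 * N)}

/-- Below the minimum distance 2W - W' counts only the zero word, giving 2 - 1 = 1; the even version
has 2 + 1 = 3. -/
lemma pow_mul_coeff_bin_odd (hD : IsSemiSelfDual D) (hN : 2 * #(words D) = 2 ^ N) {i : ℕ}
    (h : ∀ c ∈ dual D, c ≠ 0 → i < hammingNorm c / 2) :
    2 ^ N * coeff i (bin (4 * i - N + 1) (-2 * i - 1)) =
      2 * ((-64) ^ i * ((∑ v ∈ shadowWords D (N + 2),
        (level N (hammingNorm v) + i).choose (2 * i) : ℕ) : ℤ)) := by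
  have h1 := congrArg (fun p => coeff i (Polynomial.coeToPowerSeries.ringHom p *
    bin (4 * i - N + 1) (-2 * i - 1))) (hD.halfEnum_sub hN)
  simp only [map_mul, map_sub, map_pow, map_ofNat, map_sum] at h1
  have hC : (2 : ℤ⟦X⟧) = C 2 := (map_ofNat _ 2).symm
  rw [mul_assoc, mul_assoc 2, sub_mul, mul_assoc 2, hC, ← map_pow, coeff_C_mul, coeff_C_mul, map_sub,
    coeff_C_mul, Polynomial.coeToPowerSeries.ringHom_apply,
    Polynomial.coeToPowerSeries.ringHom_apply, coeff_halfEnum_mul h,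
    coeff_halfEnum_mul fun c hc => h c (hD.self_orthogonal hc), sum_mul, map_sum] at h1
  rw [Nat.cast_sum, mul_sum]
  rw [sum_congr rfl fun v hv => by
    rw [Polynomial.coeToPowerSeries.ringHom_apply, coeff_oddTerm_mul_bin
      (level_le_of_odd (hammingNorm_le v) (mem_shadowWords.1 hv).2)]] at h1
  rw [← h1]; ring

lemma pow_mul_coeff_bin_even (hD : IsSemiSelfDual D) (hN : 2 * #(words D) = 2 ^ N) {i : ℕ}
    (h : ∀ c ∈ dual D, c ≠ 0 → i < hammingNorm c / 2) :
    2 ^ N * (3 * coeff i ((1 - 6 * X + X ^ 2) * bin (4 * i - N - 1) (-2 * i - 1))) =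
      (-64) ^ i * ((∑ v ∈ shadowWords D N,
        ((level N (hammingNorm v) + i).choose (2 * i) +
          (level N (hammingNorm v) + i - 1).choose (2 * i)) : ℕ) : ℤ) := by
  have h1 := congrArg (fun p => coeff i (Polynomial.coeToPowerSeries.ringHom p *
    ((1 - 6 * X + X ^ 2) * bin (4 * i - N - 1) (-2 * i - 1)))) (hD.halfEnum_add hN)
  simp only [map_mul, map_add, map_pow, map_ofNat, map_sum] at h1
  have hC : (2 : ℤ⟦X⟧) = C 2 := (map_ofNat _ 2).symm
  rw [mul_assoc, add_mul, mul_assoc 2] at h1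
  nth_rw 1 2 [hC] at h1
  rw [← map_pow, coeff_C_mul, map_add,
    coeff_C_mul, Polynomial.coeToPowerSeries.ringHom_apply,
    Polynomial.coeToPowerSeries.ringHom_apply, coeff_halfEnum_mul h,
    coeff_halfEnum_mul fun c hc => h c (hD.self_orthogonal hc), sum_mul, map_sum] at h1
  rw [Nat.cast_sum, mul_sum]
  rw [sum_congr rfl fun v hv => by
    rw [Polynomial.coeToPowerSeries.ringHom_apply, coeff_evenTerm_mul_bin
      (level_le_of_even (hammingNorm_le v))]] at h1
  rw [← h1]; ring

end IsSemiSelfDual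

/-! ### Contradictions for each residue class -/

lemma minDist_le_of_exists {n : ℕ} {C : Code n} {k : ℕ}
    (h : ¬ ∀ c ∈ C, c ≠ 0 → k < hammingNorm c) : minDist C ≤ (k : ℕ∞) := by
  push Not at h
  obtain ⟨c, hc, hc0, hk⟩ := h
  exact (iInf₂_le c ⟨hc, hc0⟩).trans (by exact_mod_cast hk)

lemma hammingNorm_add_one {n : ℕ} (v : Fin n → ZMod 2) :
    hammingNorm (v + 1) + hammingNorm v = n := by
  have h : hammingNorm (v + 1) = #{i | ¬ (v i ≠ 0)} := by
    refine congrArg card (filter_congr fun i _ => ?_)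
    have : ∀ t : ZMod 2, t + 1 ≠ 0 ↔ ¬ t ≠ 0 := by decide
    exact this (v i)
  rw [h, add_comm]
  have := card_filter_add_card_filter_not (s := (univ : Finset (Fin n))) (fun i => v i ≠ 0)
  simpa [hammingNorm] using this

namespace IsSemiSelfDual

variable {N : ℕ} {D : Code (2 * N)}

/-- With i = 2m + 1 odd, the shadow side is ≤ 0, while s ≤ 7 leaves a positive exponent b = 8 - s
and a positive coefficient. -/
lemma not_forall_lt_of_le_seven (hD : IsSemiSelfDual D) (hN : 2 * #(words D) = 2 ^ N) {m s : ℕ}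
    (hs : s ≤ 7) (hNs : N = 12 * m + s) :
    ¬ ∀ c ∈ dual D, c ≠ 0 → 4 * m + 2 < hammingNorm c := by
  intro h
  have h1 := hD.pow_mul_coeff_bin_odd hN (i := 2 * m + 1) fun c hc hc0 => by
    have := h c hc hc0
    obtain ⟨k, hk⟩ := hD.even_hammingNorm hc
    omega
  have h2 := coeff_bin_pos_of_odd (a := 4 * (2 * m + 1 : ℕ) - N + 1) (c := -2 * (2 * m + 1 : ℕ) - 1)
    (d := 4 * m + 2) (b := 8 - s) (m := m) (by omega) (by omega) (by omega)
  have h3 : (-64 : ℤ) ^ (2 * m + 1) < 0 := Odd.pow_neg (by simp) (by norm_num)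
  refine absurd h1 (ne_of_gt (lt_of_le_of_lt ?_ (mul_pos (by positivity) h2)))
  exact mul_nonpos_of_nonneg_of_nonpos zero_le_two
    (mul_nonpos_of_nonpos_of_nonneg h3.le (Nat.cast_nonneg _))

/-- With i = 2m + 2 even, the shadow side is ≥ 0; `mul_coeff_bin` makes the other side negative as
long as b = 11 - s is positive. -/
lemma not_forall_lt_of_le_ten (hD : IsSemiSelfDual D) (hN : 2 * #(words D) = 2 ^ N) (hN0 : 0 < N)
    {m s : ℕ} (hs : s ≤ 10) (hNs : N = 12 * m + s) :
    ¬ ∀ c ∈ dual D, c ≠ 0 → 4 * m + 4 < hammingNorm c := by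
  intro h
  have h1 := hD.pow_mul_coeff_bin_even hN (i := 2 * m + 1 + 1) fun c hc hc0 => by
    have := h c hc hc0
    obtain ⟨k, hk⟩ := hD.even_hammingNorm hc
    omega
  have h2 := coeff_bin_pos_of_odd (a := 4 * (2 * m + 1 + 1 : ℕ) - N - 1)
    (c := -2 * (2 * m + 1 + 1 : ℕ)) (d := 4 * m + 3) (b := 11 - s) (m := m)
    (by omega) (by omega) (by omega)
  have h3 : 0 < (-64 : ℤ) ^ (2 * m + 1 + 1) := Even.pow_pos (by simp [Nat.even_add]) (by norm_num)
  have h4 := mul_coeff_bin N (2 * m + 1)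
  have hN1 : (0 : ℤ) < N := by exact_mod_cast hN0
  have h5 := neg_of_mul_neg_right (h4.trans_lt (by nlinarith)) (by positivity)
  refine absurd h1 (ne_of_lt (lt_of_lt_of_le (b := 0) ?_ (mul_nonneg h3.le (Nat.cast_nonneg _))))
  exact mul_neg_of_pos_of_neg (by positivity) (by linarith)

lemma not_forall_lt_of_eq_eleven (hD : IsSemiSelfDual D) (hN : 2 * #(words D) = 2 ^ N)
    {m : ℕ} (hNs : N = 12 * m + 11) :
    ¬ ∀ c ∈ dual D, c ≠ 0 → 4 * m + 6 < hammingNorm c := by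
  intro h
  have hi : ∀ i, i ≤ 2 * m + 3 → ∀ c ∈ dual D, c ≠ 0 → i < hammingNorm c / 2 := by
    intro i hi c hc hc0
    have := h c hc hc0
    obtain ⟨k, hk⟩ := hD.even_hammingNorm hc
    omega
  have h1 := hD.pow_mul_coeff_bin_even hN (hi (2 * m + 1 + 1) (by omega))
  have h2 := coeff_bin_eq_zero_of_odd (a := 4 * (2 * m + 1 + 1 : ℕ) - N - 1)
    (c := -2 * (2 * m + 1 + 1 : ℕ)) (d := 4 * m + 3) (m := m) (by omega) (by omega)
  have h3 := mul_coeff_bin N (2 * m + 1)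
  rw [h2, mul_zero] at h3
  -- Now b = 0, so the odd coefficient vanishes. Every shadow word of weight ≡ N mod 4 then has
  -- level below 2m + 2, which also annihilates the sum for i = 2m + 3.
  rw [(mul_eq_zero.1 h3).resolve_left (by positivity), mul_zero, mul_zero] at h1
  have h4 := (mul_eq_zero.1 h1.symm).resolve_left (by positivity)
  rw [Nat.cast_eq_zero, sum_eq_zero_iff] at h4
  have h5 := hD.pow_mul_coeff_bin_even hN (hi (2 * m + 2 + 1) (by omega))
  rw [sum_eq_zero, Nat.cast_zero, mul_zero] at h5
  · have h6 := (mul_eq_zero.1 ((mul_eq_zero.1 h5).resolve_left (by positivity))).resolve_left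
      (by norm_num)
    have h7 := mul_coeff_bin N (2 * m + 2)
    rw [h6, mul_zero] at h7
    have h8 := coeff_bin_pos_of_even (a := 4 * (2 * m + 2 + 1 : ℕ) - N - 1)
      (c := -2 * (2 * m + 2 + 1 : ℕ)) (d := 4 * m + 5) (b := 6) (m := m + 1) (by omega) (by omega)
    rw [show 2 * (m + 1) = 2 * m + 2 by ring] at h8
    rcases mul_eq_zero.1 h7.symm with h9 | h9
    · omega
    · exact h8.ne' h9
  · intro v hv
    have h6 := Nat.choose_eq_zero_iff.1 (Nat.add_eq_zero_iff.1 (h4 v hv)).1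
    rw [Nat.choose_eq_zero_of_lt (by omega), Nat.choose_eq_zero_of_lt (by omega), add_zero]

lemma add_one_mem_shadowWords (hD : IsSemiSelfDual D) {v : Fin (2 * N) → ZMod 2}
    (hv : v ∈ shadowWords D (N + 2)) : v + 1 ∈ shadowWords D (N + 2) := by
  rw [mem_shadowWords] at hv ⊢
  refine ⟨fun c hc => ?_, ?_⟩
  · have h1 := hv.1 c hc
    have h2 := mem_dual.1 (hD.self_orthogonal hc) 1 hD.one_mem
    rw [twist, add_dotProduct, dotProduct_comm 1 c, h2, add_zero]
    exact h1
  · have := hammingNorm_add_one v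
    omega

lemma level_hammingNorm_add_one (v : Fin (2 * N) → ZMod 2) :
    level N (hammingNorm (v + 1)) = level N (hammingNorm v) := by
  have := hammingNorm_add_one v
  rw [level, level]; omega

lemma even_sum_shadowWords (hD : IsSemiSelfDual D) (hN0 : 0 < N) (f : ℕ → ℕ) :
    Even (∑ v ∈ shadowWords D (N + 2), f (level N (hammingNorm v))) := by
  rw [← ZMod.natCast_eq_zero_iff_even, Nat.cast_sum]
  refine sum_involution (fun v _ => v + 1) (fun v _ => ?_) (fun v _ _ => ?_)
    (fun v hv => hD.add_one_mem_shadowWords hv) (fun v _ => ?_)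
  · rw [level_hammingNorm_add_one]; exact CharTwo.add_self_eq_zero _
  · intro h
    have := congrFun h ⟨0, by omega⟩
    simp at this
  · rw [add_assoc]
    funext i
    have : (1 + 1 : ZMod 2) = 0 := by decide
    simp [this]

lemma not_forall_lt_of_isDoublyEven (hD : IsSemiSelfDual D) (hN : 2 * #(words D) = 2 ^ N)
    (hDE : IsDoublyEven D) {m : ℕ} (hNm : N = 12 * m) :
    ¬ ∀ c ∈ dual D, c ≠ 0 → 4 * m < hammingNorm c := by
  intro h
  have h1 := hD.pow_mul_coeff_bin_odd hN (i := 2 * m) fun c hc hc0 => by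
    have := h c hc hc0
    obtain ⟨k, hk⟩ := hD.even_hammingNorm hc
    omega
  have h2 := coeff_bin_pos_of_even (a := 4 * (2 * m : ℕ) - N + 1) (c := -2 * (2 * m : ℕ) - 1)
    (d := 4 * m) (b := 2) (m := m) (by omega) (by omega)
  have h3 : ∑ v ∈ shadowWords D (N + 2),
      (level N (hammingNorm v) + 2 * m).choose (2 * (2 * m)) ≠ 0 := by
    intro h0
    rw [h0, Nat.cast_zero, mul_zero, mul_zero] at h1
    exact (mul_pos (by positivity) h2).ne' h1
  -- Level at least 2m puts wt v at distance at least 8m from 12m, so v or v + 1 has weight at most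
  -- 4m.
  obtain ⟨v, hv, hv0⟩ := exists_ne_zero_of_sum_ne_zero h3
  have hl : 2 * m ≤ level N (hammingNorm v) := by
    by_contra hlt
    exact hv0 (Nat.choose_eq_zero_of_lt (by omega))
  -- On a doubly-even code the factor i^wt(c) is 1, so a trivial twist means orthogonality.
  have hmem : ∀ u ∈ shadowWords D (N + 2), u ∈ dual D := by
    intro u hu c hc
    have h4 := (mem_shadowWords.1 hu).1 c hc
    obtain ⟨k, hk⟩ := hDE c hc
    rw [twist, hk, pow_mul, Complex.I_pow_four, one_pow, one_mul] at h4
    refine (zmod_two_cases _).resolve_right fun h5 => ?_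
    rw [h5, sgn_one] at h4
    norm_num at h4
  have key : ∀ u ∈ shadowWords D (N + 2), 4 * m < hammingNorm u := by
    intro u hu
    refine h u (hmem u hu) ?_
    rintro rfl
    have := (mem_shadowWords.1 hu).2
    rw [hammingNorm_zero] at this
    omega
  have h4 := key v hv
  have h5 := key (v + 1) (hD.add_one_mem_shadowWords hv)
  have h6 := hammingNorm_add_one v
  have h7 := (mem_shadowWords.1 hv).2
  rw [level] at hl
  omega

/-- With μ = m + 1, the X^(2μ) coefficient of (1+X)²/(1-X²)^(4μ+1) is C(5μ, μ) + C(5μ-1, μ-1), and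
the first term is 5 times the second. -/
lemma coeff_two_mul_bin (m : ℕ) :
    coeff (2 * (m + 1)) (bin (2 - (4 * (m + 1) + 1 : ℕ)) (-(4 * (m + 1) + 1 : ℕ))) =
      6 * ((5 * (m + 1) - 1).choose m : ℤ) := by
  have h : bin (2 - (4 * (m + 1) + 1 : ℕ)) (-(4 * (m + 1) + 1 : ℕ)) =
      bin (-(4 * (m + 1) + 1 : ℕ)) (-(4 * (m + 1) + 1 : ℕ)) +
      X * (bin (-(4 * (m + 1) + 1 : ℕ)) (-(4 * (m + 1) + 1 : ℕ)) +
      (bin (-(4 * (m + 1) + 1 : ℕ)) (-(4 * (m + 1) + 1 : ℕ)) +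
      X * bin (-(4 * (m + 1) + 1 : ℕ)) (-(4 * (m + 1) + 1 : ℕ)))) := by
    have h1 := one_add_X_mul_bin (-(4 * (m + 1) + 1 : ℕ)) (-(4 * (m + 1) + 1 : ℕ))
    have h2 := one_add_X_mul_bin (-(4 * (m + 1) + 1 : ℕ) + 1) (-(4 * (m + 1) + 1 : ℕ))
    rw [show (2 - (4 * (m + 1) + 1 : ℕ) : ℤ) = -(4 * (m + 1) + 1 : ℕ) + 1 + 1 by ring, ← h2, ← h1]
    ring
  rw [h, bin_neg_neg, show 2 * (m + 1) = 2 * m + 1 + 1 by ring]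
  simp only [map_add, coeff_succ_X_mul, coeff_mk]
  rw [if_pos (by simp [Nat.even_add]), if_neg (by simp), if_pos (by simp),
    show (2 * m + 1 + 1) / 2 = m + 1 by omega, show 2 * m / 2 = m by omega,
    show 4 * (m + 1) + (m + 1) = 5 * m + 4 + 1 by ring, show 4 * (m + 1) + m = 5 * m + 4 by ring,
    show 5 * (m + 1) - 1 = 5 * m + 4 by omega,
    Nat.choose_symm_of_eq_add (show 5 * m + 4 + 1 = 4 * (m + 1) + (m + 1) by ring),
    Nat.choose_symm_of_eq_add (show 5 * m + 4 = 4 * (m + 1) + m by ring)]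
  have h3 := Nat.add_one_mul_choose_eq (5 * m + 4) m
  have h4 : (5 * m + 4 + 1).choose (m + 1) = 5 * (5 * m + 4).choose m := by
    refine Nat.eq_of_mul_eq_mul_right (Nat.succ_pos m) ?_
    rw [Nat.succ_eq_add_one, ← h3]; ring
  rw [h4]; push_cast; ring

/-- Since 64^(2m) = 2^(12m) = 2^N, the powers cancel and leave 6 C(5m-1, m-1) equal to twice an even
number, so the binomial is even. -/
lemma not_forall_lt_of_odd_choose (hD : IsSemiSelfDual D) (hN : 2 * #(words D) = 2 ^ N)
    (hN0 : 0 < N) {m : ℕ} (hNm : N = 12 * m) (hodd : Odd ((5 * m - 1).choose (m - 1))) :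
    ¬ ∀ c ∈ dual D, c ≠ 0 → 4 * m < hammingNorm c := by
  intro h
  have h1 := hD.pow_mul_coeff_bin_odd hN (i := 2 * m) fun c hc hc0 => by
    have := h c hc hc0
    obtain ⟨k, hk⟩ := hD.even_hammingNorm hc
    omega
  obtain ⟨T, hT⟩ := hD.even_sum_shadowWords hN0 fun l => (l + 2 * m).choose (2 * (2 * m))
  obtain ⟨k, rfl⟩ : ∃ k, m = k + 1 := ⟨m - 1, by omega⟩
  have h2 : (-64 : ℤ) ^ (2 * (k + 1)) = 2 ^ N := by
    rw [hNm, pow_mul, pow_mul]; norm_num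
  rw [hT, h2, show (4 * (2 * (k + 1) : ℕ) - N + 1 : ℤ) = 2 - (4 * (k + 1) + 1 : ℕ) by omega,
    show (-2 * (2 * (k + 1) : ℕ) - 1 : ℤ) = -(4 * (k + 1) + 1 : ℕ) by omega, coeff_two_mul_bin,
    mul_left_comm 2] at h1
  have h3 := mul_left_cancel₀ (pow_ne_zero N two_ne_zero) h1
  obtain ⟨r, hr⟩ := hodd
  rw [Nat.add_sub_cancel] at hr
  rw [hr] at h3
  omega

end IsSemiSelfDual

end BinaryCode

theorem theorem2 {n : ℕ} (D : BinaryCode.Code n) (hD : BinaryCode.IsSemiSelfDual D) :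
    (n % 24 ∈ ({0, 2, 4, 6, 8, 10, 12, 14} : Finset ℕ) →
      BinaryCode.minDist (BinaryCode.dual D) ≤ ((4 * (n / 24) + 2 : ℕ) : ℕ∞)) ∧
    (n % 24 ∈ ({16, 18, 20} : Finset ℕ) →
      BinaryCode.minDist (BinaryCode.dual D) ≤ ((4 * (n / 24) + 4 : ℕ) : ℕ∞)) ∧
    (n % 24 = 22 →
      BinaryCode.minDist (BinaryCode.dual D) ≤ ((4 * (n / 24) + 6 : ℕ) : ℕ∞)) ∧
    (∀ μ : ℕ, n = 24 * μ →
      (BinaryCode.IsDoublyEven D ∨ Odd (Nat.choose (5 * μ - 1) (μ - 1))) →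
      BinaryCode.minDist (BinaryCode.dual D) ≤ ((4 * μ : ℕ) : ℕ∞)) := by
  obtain ⟨N, hN0, rfl, hN⟩ := hD.exists_length
  refine ⟨fun h => ?_, fun h => ?_, fun h => ?_, fun μ hμ h => ?_⟩ <;>
    refine BinaryCode.minDist_le_of_exists ?_
  · simp only [Finset.mem_insert, Finset.mem_singleton] at h
    exact hD.not_forall_lt_of_le_seven hN (s := N - 12 * (2 * N / 24)) (by omega) (by omega)
  · simp only [Finset.mem_insert, Finset.mem_singleton] at h
    exact hD.not_forall_lt_of_le_ten hN hN0 (s := N - 12 * (2 * N / 24)) (by omega) (by omega)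
  · exact hD.not_forall_lt_of_eq_eleven hN (by omega)
  · rcases h with h | h
    · exact hD.not_forall_lt_of_isDoublyEven hN h (by omega)
    · exact hD.not_forall_lt_of_odd_choose hN hN0 (by omega) h
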